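/- A continuum is a nonempty compact, connected, metrizable space; it carries its unique compatible uniformity. A \emph{cover of a continuum $X$ by a continuum} is a map $f_i:X_i\to X=X_i/G_i$ with $X_i$ a continuum that is a covering map in the usual sense and also the quotient map of a free action of a group $G_i$ of homeomorphisms of $X_i$. Fix a basepoint in $X$ and basepoints in all $X_i$ over it. Up to equivalence the covers of $X$ by continua are ordered by $f_i\le f_j$ if there is a basepoint-preserving continuous surjection $f_{ij}:X_j\to X_i$ with $f_j=f_i\circ f_{ij}$, and with these bonding maps they form an inverse system; the groups $G_i$ form an inverse system with the homomorphisms $\theta_{ij}:G_j\to G_i$ determined by $\theta_{ij}(g)\circ f_{ij}=f_{ij}\circ g$. The \emph{compact universal cover} of $X$ is the inverse limit $\widehat X=\varprojlim X_i$ with its projection $\widehat\phi_X:\widehat X\to X$, and the \emph{profinite fundamental group} of $X$ is $\pi_P(X)=\varprojlim G_i$, which acts on $\widehat X$ coordinatewise. A group $G$ of bijections of a uniform space $Y$ acts \emph{isomorphically} if $Y$ has a basis of $G$-invariant entourages. For an entourage $E$ let $U_E(G)=\{g\in G:(y,g(y))\in E\text{ for all }y\in Y\}$, and let $N_E(G)$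 be the subgroup generated by $\{g\in G:(y,g(y))\in E\text{ for some }y\in Y\}$; $G$ acts \emph{prodiscretely} if for every entourage $E$ there is an entourage $F$ with $N_F(G)\subset U_E(G)$. A \emph{generalized regular covering map} $f:Y\to X=Y/G$ is the quotient map (with $X$ carrying the quotient uniformity) of an isomorphic and prodiscrete action of a group $G$ that is complete in the uniformity of uniform convergence. \textbf{Corollary.} Let $X$ and $Y$ be continua and let $f:Y\to X=Y/G$ be a generalized regular covering map. For any choice of basepoints of $X$ and $Y$ in the construction of $\widehat X$ and $\widehat Y$, there is a homeomorphism $h:\widehat X\to\widehat Y$ such that $$\widehat\phi_X=f\circ\widehat\phi_Y\circ h,$$ and $h$ is unique modulo $\pi_P(X)$: the homeomorphisms $h':\widehat X\to\widehat Y$ with $\widehat\phi_X=f\circ\widehat\phi_Y\circ h'$ are precisely the maps $h\circ g$ with $g\in\pi_P(X)$. -/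

import Mathlib

open Set Filter Topology Uniformity

universe u v

/-- A continuum: a (nonempty) compact, connected, metrizable topological space. -/
class IsContinuum (X : Type u) [TopologicalSpace X] : Prop extends
  CompactSpace X, ConnectedSpace X, TopologicalSpace.MetrizableSpace X

section UniformActions

variable {X : Type u} {Y : Type v} [UniformSpace X] [UniformSpace Y]

/-- A group `G` of bijections acts isomorphically on the uniform space `Y` if the uniformity has
a basis of entourages `E` with `g(E) = E` for all `g ∈ G`. -/
def ActsIsomorphically (G : Subgroup (Equiv.Perm Y)) : Prop :=
  ∀ E ∈ 𝓤 Y, ∃ F ∈ 𝓤 Y, F ⊆ E ∧ ∀ g ∈ G, Prod.map g g '' F = F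

/-- `U_E(G)`: the elements of `G` that move every point by less than `E`. -/
def uniformSmall (G : Subgroup (Equiv.Perm Y)) (E : Set (Y × Y)) : Set (Equiv.Perm Y) :=
  {g | g ∈ G ∧ ∀ y, (y, g y) ∈ E}

/-- `S_E(G)`: the elements of `G` that move some point by less than `E`. -/
def somewhereSmall (G : Subgroup (Equiv.Perm Y)) (E : Set (Y × Y)) : Set (Equiv.Perm Y) :=
  {g | g ∈ G ∧ ∃ y, (y, g y) ∈ E}

/-- `N_E(G)`: the subgroup generated by `S_E(G)`. -/
def smallSubgroup (G : Subgroup (Equiv.Perm Y)) (E : Set (Y × Y)) : Subgroup (Equiv.Perm Y) :=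
  Subgroup.closure (somewhereSmall G E)

/-- `G` acts prodiscretely: every entourage `E` admits an entourage `F` with
`N_F(G) ⊆ U_E(G)`. -/
def ActsProdiscretely (G : Subgroup (Equiv.Perm Y)) : Prop :=
  ∀ E ∈ 𝓤 Y, ∃ F ∈ 𝓤 Y, (smallSubgroup G F : Set (Equiv.Perm Y)) ⊆ uniformSmall G E

/-- `G` is complete for the uniformity of uniform convergence (`Y →ᵤ Y` carries it).  For an
isomorphic action this is both the left and the right uniformity of the topological group `G`
with the sets `U_E(G)` as a basis at the identity. -/
def IsCompleteGroup (G : Subgroup (Equiv.Perm Y)) : Prop :=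
  IsComplete ((fun g : Equiv.Perm Y => UniformFun.ofFun (g : Y → Y)) '' (G : Set (Equiv.Perm Y)))

/-- Bi-uniformly continuous: a uniformly continuous surjection that takes entourages to
entourages. -/
def BiUniformlyContinuous (f : Y → X) : Prop :=
  UniformContinuous f ∧ Function.Surjective f ∧ ∀ E ∈ 𝓤 Y, Prod.map f f '' E ∈ 𝓤 X

/-- `f : Y → X = Y/G` is a generalized regular covering map with deck group `G`: the group `G` of
bijections of `Y` is complete and acts isomorphically and prodiscretely, and `f` is the quotient
map of the action, i.e. its point preimages are the orbits of `G` and `X` carries the quotient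
uniformity. -/
structure IsGeneralizedRegularCovering (G : Subgroup (Equiv.Perm Y)) (f : Y → X) : Prop where
  isomorphic : ActsIsomorphically G
  prodiscrete : ActsProdiscretely G
  complete : IsCompleteGroup G
  biUniform : BiUniformlyContinuous f
  orbits : ∀ y z : Y, f y = f z ↔ ∃ g ∈ G, g y = z

end UniformActions

section CompactUniversalCover

/-- `f : Y → X = Y/G` is a regular covering map: a covering map that is also the quotient map of
a free action by the group `G` of homeomorphisms. -/
structure IsRegularCovering {X : Type u} {Y : Type v} [TopologicalSpace X] [TopologicalSpace Y]
    (G : Subgroup (Y ≃ₜ Y)) (f : Y → X) : Prop where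
  covering : IsCoveringMap f
  quotient : IsQuotientMap f
  free : ∀ g ∈ G, ∀ y : Y, g y = y → g = 1
  orbits : ∀ y z : Y, f y = f z ↔ ∃ g ∈ G, g y = z

/-- A pointed regular cover of `(X, x₀)` by a continuum. -/
structure ContinuumCover (X : Type u) [TopologicalSpace X] (x₀ : X) where
  space : Type u
  [top : TopologicalSpace space]
  [continuum : IsContinuum space]
  /-- the group of the cover -/
  group : Subgroup (space ≃ₜ space)
  /-- the covering map -/
  proj : space → X
  regular : IsRegularCovering group proj
  /-- the basepoint -/
  base : space
  proj_base : proj base = x₀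

attribute [instance] ContinuumCover.top ContinuumCover.continuum

variable {X : Type u} [TopologicalSpace X]

/-- `b` is the bonding map exhibiting `c ≤ d`: a continuous surjection of covers of `X` that
preserves basepoints.  (There is at most one for given `c` and `d`.) -/
structure IsBondingMap {x₀ : X} (c d : ContinuumCover X x₀) (b : d.space → c.space) : Prop where
  continuous : Continuous b
  surjective : Function.Surjective b
  proj_comp : c.proj ∘ b = d.proj
  map_base : b d.base = c.base

/-- `X̂`: the inverse limit of all covers of `X` by continua, as a subspace of the product.
Equivalent covers are linked by a bonding homeomorphism, so letting all of them, and not only one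
of each equivalence class, take part in the limit does not change it. -/
def CompactUniversalCover (X : Type u) [TopologicalSpace X] (x₀ : X) : Type (u + 1) :=
  {s : (c : ContinuumCover X x₀) → c.space //
    ∀ (c d : ContinuumCover X x₀) (b : d.space → c.space), IsBondingMap c d b → b (s d) = s c}

instance (x₀ : X) : TopologicalSpace (CompactUniversalCover X x₀) :=
  inferInstanceAs (TopologicalSpace {s : (c : ContinuumCover X x₀) → c.space //
    ∀ (c d : ContinuumCover X x₀) (b : d.space → c.space), IsBondingMap c d b → b (s d) = s c})

/-- The identity of `X`, the smallest cover. -/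
def trivialCover (X : Type u) [TopologicalSpace X] [IsContinuum X] (x₀ : X) :
    ContinuumCover X x₀ where
  space := X
  group := ⊥
  proj := id
  regular :=
    { covering := isLocalHomeomorph_iff_isCoveringMap.1 (Homeomorph.refl X).isLocalHomeomorph
      quotient := IsQuotientMap.id
      free := fun _ hg _ _ => Subgroup.mem_bot.1 hg
      orbits := fun y z => by simp }
  base := x₀
  proj_base := rfl

/-- `φ̂ : X̂ → X`, the projection of the inverse limit to `X`. -/
def compactUniversalCovering (X : Type u) [TopologicalSpace X] [IsContinuum X] (x₀ : X) :
    CompactUniversalCover X x₀ → X :=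
  fun s => s.1 (trivialCover X x₀)

/-- `π_P(X)`: the inverse limit of the groups of the covers of `X` by continua.  The bonding
homomorphism `θ` of a bonding map `b` sends `g` to the (unique) `θ g` with `θ g ∘ b = b ∘ g`. -/
def profiniteFundamentalGroup (X : Type u) [TopologicalSpace X] (x₀ : X) :
    Subgroup ((c : ContinuumCover X x₀) → c.group) where
  carrier := {g | ∀ (c d : ContinuumCover X x₀) (b : d.space → c.space), IsBondingMap c d b →
    ∀ z : d.space, (g c : c.space ≃ₜ c.space) (b z) = b ((g d : d.space ≃ₜ d.space) z)}
  one_mem' := fun _ _ _ _ _ => rfl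
  mul_mem' := by
    intro g h hg hh c d b hb z
    change (g c : c.space ≃ₜ c.space) ((h c : c.space ≃ₜ c.space) (b z))
      = b ((g d : d.space ≃ₜ d.space) ((h d : d.space ≃ₜ d.space) z))
    rw [hh c d b hb, hg c d b hb]
  inv_mem' := by
    intro g hg c d b hb z
    change (g c : c.space ≃ₜ c.space).symm (b z) = b ((g d : d.space ≃ₜ d.space).symm z)
    rw [Homeomorph.symm_apply_eq, hg c d b hb, Homeomorph.apply_symm_apply]

/-- The action of `π_P(X)` on `X̂`, coordinate by coordinate. -/
instance (x₀ : X) :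
    MulAction (profiniteFundamentalGroup X x₀) (CompactUniversalCover X x₀) where
  smul g s := ⟨fun c => (g.1 c : c.space ≃ₜ c.space) (s.1 c), fun c d b hb => by
    rw [← g.2 c d b hb, s.2 c d b hb]⟩
  one_smul _ := rfl
  mul_smul _ _ _ := rfl

end CompactUniversalCover

/-! ### Local homeomorphisms and fibre products -/

section LocalHomeomorphisms

variable {A B Z X : Type*} [TopologicalSpace A] [TopologicalSpace B] [TopologicalSpace Z]
  [TopologicalSpace X]

/-! `X̂` is connected and has a lifting property: its projection lifts, with a prescribed value at
one point, through every local homeomorphism `q : Z → X` with `Z` compact metrizable. The reason is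
a Galois closure: a component of the space of enumerations of the fibres of `q` is a regular cover
of `X` by a continuum that dominates `q` (`exists_continuumCover_dominating`).

If `π : Z → Y` is a finite covering, then `f ∘ π` need not be a local homeomorphism, but it is a
limit of such maps. A small subgroup `N_F(G)` moves all points so little that it lifts uniquely to
`Z`, and dividing `Z` by the lifts gives a finite covering of `X` (`exists_setoid`, `exists_stage`).
Lifts to these quotients fit together by compactness, so the projection of `X̂` lifts through `f ∘
π`, uniquely once one value is fixed.

Lifting to all covers of `Y` gives `X̂ → Ŷ`. Conversely, covers of `X` pull back along `f` to `Y`,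
which gives `Ŷ → X̂`. Uniqueness of lifts makes the two maps inverse to each other. Two solutions
differ by a self-map of `X̂` over `X`, which on each cover agrees with the deck transformation
determined by one value. -/

theorem IsLocalHomeomorph.of_isOpenMap_isLocallyInjective {q : Z → X} (hc : Continuous q)
    (ho : IsOpenMap q) (hi : IsLocallyInjective q) : IsLocalHomeomorph q := by
  rw [isLocalHomeomorph_iff_isOpenEmbedding_restrict]
  intro z
  obtain ⟨U, hU, hz, hinj⟩ := hi z
  refine ⟨U, hU.mem_nhds hz, .of_continuous_injective_isOpenMap
    (hc.comp continuous_subtype_val) (fun a b h => Subtype.ext (hinj a.2 b.2 h))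
    (ho.comp hU.isOpenMap_subtype_val)⟩

/-- The image is open, and compact hence closed. -/
theorem IsLocalHomeomorph.surjective_of_compact [CompactSpace Z] [T2Space X] [PreconnectedSpace X]
    [Nonempty Z] {q : Z → X} (hq : IsLocalHomeomorph q) : Function.Surjective q := by
  have h : IsClopen (range q) :=
    ⟨(isCompact_range hq.continuous).isClosed, hq.isOpenMap.isOpen_range⟩
  exact range_eq_univ.1 (h.eq_univ (range_nonempty q))

theorem IsLocalHomeomorph.lift_unique [T2Space Z] [PreconnectedSpace A] {q : Z → X}
    (hq : IsLocalHomeomorph q) {l m : A → Z} (hl : Continuous l) (hm : Continuous m)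
    (h : ∀ a, q (l a) = q (m a)) {a₀ : A} (h₀ : l a₀ = m a₀) : l = m :=
  (T2Space.isSeparatedMap q).eq_of_comp_eq hq.isLocallyInjective hl hm (funext h) a₀ h₀

/-- The fibre product of two maps. -/
abbrev FibreProduct {A B X : Type*} (a : A → X) (b : B → X) : Type _ :=
  {p : A × B | a p.1 = b p.2}

theorem FibreProduct.compactSpace [CompactSpace A] [CompactSpace B] [T2Space X] {a : A → X}
    {b : B → X} (ha : Continuous a) (hb : Continuous b) : CompactSpace (FibreProduct a b) :=
  isCompact_iff_compactSpace.1
    (isClosed_eq (ha.comp continuous_fst) (hb.comp continuous_snd)).isCompact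

/-- The first projection of a fibre product. -/
def FibreProduct.fst {A B X : Type*} {a : A → X} {b : B → X} (p : FibreProduct a b) : A := p.1.1

/-- The second projection of a fibre product. -/
def FibreProduct.snd {A B X : Type*} {a : A → X} {b : B → X} (p : FibreProduct a b) : B := p.1.2

theorem FibreProduct.comm {A B X : Type*} {a : A → X} {b : B → X} (p : FibreProduct a b) :
    a p.fst = b p.snd := p.2

theorem FibreProduct.continuous_fst {A B X : Type*} [TopologicalSpace A] [TopologicalSpace B]
    {a : A → X} {b : B → X} : Continuous (FibreProduct.fst : FibreProduct a b → A) :=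
  _root_.continuous_fst.comp continuous_subtype_val

theorem FibreProduct.continuous_snd {A B X : Type*} [TopologicalSpace A] [TopologicalSpace B]
    {a : A → X} {b : B → X} : Continuous (FibreProduct.snd : FibreProduct a b → B) :=
  _root_.continuous_snd.comp continuous_subtype_val

theorem FibreProduct.isLocalHomeomorph_fst {a : A → X} {b : B → X} (ha : Continuous a)
    (hb : IsLocalHomeomorph b) : IsLocalHomeomorph (FibreProduct.fst : FibreProduct a b → A) := by
  refine .of_isOpenMap_isLocallyInjective continuous_fst ?_ ?_
  · rw [isOpenMap_iff_nhds_le]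
    intro p s hs
    obtain ⟨t, ht, hts⟩ := mem_nhds_subtype _ _ _ |>.1
      (show Prod.fst ∘ Subtype.val ⁻¹' s ∈ 𝓝 p from hs)
    obtain ⟨U, hU, V, hV, hUV⟩ := mem_nhds_prod_iff.1 ht
    have hV' : b '' V ∈ 𝓝 (a p.1.1) := by
      rw [p.2]; exact hb.isOpenMap.image_mem_nhds hV
    filter_upwards [hU, ha.continuousAt hV'] with x hx hx'
    obtain ⟨y, hy, hyx⟩ := hx'
    exact hts (a := ⟨(x, y), hyx.symm⟩) (hUV ⟨hx, hy⟩)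
  · intro p
    obtain ⟨V, hV, hp, hinj⟩ := hb.isLocallyInjective p.snd
    refine ⟨_, hV.preimage continuous_snd, hp, fun r hr s hs h => Subtype.ext (Prod.ext h ?_)⟩
    exact hinj hr hs (r.comm.symm.trans ((congrArg a h).trans s.comm))

end LocalHomeomorphisms

/-- Disjoint closed pieces of the intersection have disjoint open neighbourhoods. By compactness
some `K i` already lies in their union, hence in one of them. -/
theorem isPreconnected_iInter_of_directed {A ι : Type*} [TopologicalSpace A] [CompactSpace A]
    [T2Space A] [Nonempty ι] (K : ι → Set A) (hd : Directed (· ⊇ ·) K) (hK : ∀ i, IsClosed (K i))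
    (hc : ∀ i, IsPreconnected (K i)) : IsPreconnected (⋂ i, K i) := by
  rw [isPreconnected_iff_subset_of_fully_disjoint_closed (isClosed_iInter hK)]
  intro u v hu hv huv hdisj
  obtain ⟨U, V, hU, hV, hUu, hVv, hUV⟩ := normal_separation hu hv hdisj
  obtain ⟨i, hi⟩ := exists_subset_nhds_of_isCompact' hd (fun i => (hK i).isCompact) hK
    (U := U ∪ V) fun x hx => (hU.union hV).mem_nhds (union_subset_union hUu hVv (huv hx))
  rcases (hc i).subset_or_subset hU hV hUV hi with h | h
  · left
    intro x hx
    refine (huv hx).resolve_right fun hxv => ?_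
    exact hUV.le_bot ⟨h (iInter_subset K i hx), hVv hxv⟩
  · right
    intro x hx
    refine (huv hx).resolve_left fun hxu => ?_
    exact hUV.le_bot ⟨hUu hxu, h (iInter_subset K i hx)⟩

/-! ### Galois closure: tuples in the fibres -/

section GaloisClosure

variable {Z X : Type u} [TopologicalSpace Z] [TopologicalSpace X]

/-- The `n`-tuples of different points in a common fibre of `q`, together with the point of `X`
below. -/
abbrev FibreTuples {Z X : Type u} (q : Z → X) (n : ℕ) : Type u :=
  {e : (Fin n → Z) × X | (∀ i, q (e.1 i) = e.2) ∧ Function.Injective e.1}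

namespace FibreTuples

variable {q : Z → X} {n : ℕ}

/-- The points of a tuple. -/
def point {Z X : Type u} {q : Z → X} {n : ℕ} (e : FibreTuples q n) (i : Fin n) : Z := e.1.1 i

/-- The point below a tuple. -/
def proj {Z X : Type u} {q : Z → X} {n : ℕ} (e : FibreTuples q n) : X := e.1.2

theorem point_injective {Z X : Type u} {q : Z → X} {n : ℕ} (e : FibreTuples q n) :
    Function.Injective e.point := e.2.2

theorem map_point {Z X : Type u} {q : Z → X} {n : ℕ} (e : FibreTuples q n) (i : Fin n) :
    q (e.point i) = e.proj := e.2.1 i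

theorem eq_of_point_eq {Z X : Type u} {q : Z → X} {n : ℕ} {e e' : FibreTuples q n}
    (h : e.proj = e'.proj) (h' : ∀ i, e.point i = e'.point i) : e = e' :=
  Subtype.ext (Prod.ext (funext h') h)

theorem continuous_proj : Continuous (proj : FibreTuples q n → X) :=
  continuous_snd.comp continuous_subtype_val

theorem continuous_point (i : Fin n) : Continuous fun e : FibreTuples q n => e.point i :=
  (continuous_apply i).comp (continuous_fst.comp continuous_subtype_val)

/-- Different points of a fibre cannot merge in the limit, because `q` is injective near the limit
point. -/
theorem compactSpace [CompactSpace Z] [CompactSpace X] [T2Space X] (hq : IsLocalHomeomorph q) :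
    CompactSpace (FibreTuples q n) := by
  refine isCompact_iff_compactSpace.1 (IsClosed.isCompact ?_)
  rw [← closure_subset_iff_isClosed]
  intro e he
  have h1 : ∀ i, q (e.1 i) = e.2 := by
    have : IsClosed {e : (Fin n → Z) × X | ∀ i, q (e.1 i) = e.2} := by
      simp only [ofPred_forall]
      exact isClosed_iInter fun i => isClosed_eq
        (hq.continuous.comp ((continuous_apply i).comp continuous_fst)) continuous_snd
    exact closure_minimal (fun e he => he.1) this he
  refine ⟨h1, fun i j hij => ?_⟩
  by_contra hne
  obtain ⟨U, hU, hz, hinj⟩ := hq.isLocallyInjective (e.1 i)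
  have hc : ∀ i, Continuous fun e : (Fin n → Z) × X => e.1 i :=
    fun i => (continuous_apply i).comp continuous_fst
  have hN : {e : (Fin n → Z) × X | e.1 i ∈ U ∧ e.1 j ∈ U} ∈ 𝓝 e :=
    inter_mem ((hc i).continuousAt (hU.mem_nhds hz))
      ((hc j).continuousAt (hU.mem_nhds (hij ▸ hz)))
  obtain ⟨e', ⟨hi, hj⟩, he', hinj'⟩ := mem_closure_iff_nhds.1 he _ hN
  exact hne (hinj' (hinj hi hj ((he' i).trans (he' j).symm)))

/-- Each point of a tuple can be followed over nearby base points since `q` is open, and the points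
stay different since this is an open condition. -/
theorem isLocalHomeomorph_proj [T2Space Z] (hq : IsLocalHomeomorph q) :
    IsLocalHomeomorph (proj : FibreTuples q n → X) := by
  refine .of_isOpenMap_isLocallyInjective continuous_proj ?_ ?_
  · rw [isOpenMap_iff_nhds_le]
    intro e s hs
    obtain ⟨t, ht, hts⟩ := mem_nhds_subtype _ _ _ |>.1
      (show Prod.snd ∘ Subtype.val ⁻¹' s ∈ 𝓝 e from hs)
    obtain ⟨T, hT, S, hS, hTS⟩ := mem_nhds_prod_iff.1 ht
    have hT' : T ∩ {e : Fin n → Z | Function.Injective e} ∈ 𝓝 e.point := by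
      refine inter_mem hT (IsOpen.mem_nhds ?_ e.point_injective)
      have : {e : Fin n → Z | Function.Injective e} =
          ⋂ i, ⋂ j, ⋂ _ : i ≠ j, {e : Fin n → Z | e i ≠ e j} := by
        ext e
        simp only [mem_ofPred_eq, mem_iInter, Function.Injective]
        exact forall₂_congr fun i j =>
          ⟨fun h hne he => hne (h he), fun h he => by_contra fun hne => h hne he⟩
      rw [this]
      exact isOpen_iInter_of_finite fun i => isOpen_iInter_of_finite fun j =>
        isOpen_iInter_of_finite fun _ =>
          isOpen_ne_fun (continuous_apply i) (continuous_apply j)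
    rw [nhds_pi, mem_pi'] at hT'
    obtain ⟨I, U, hU, hUT⟩ := hT'
    have hV : ∀ i, q '' U i ∈ 𝓝 e.proj := fun i => by
      rw [← e.map_point i]; exact hq.isOpenMap.image_mem_nhds (hU i)
    filter_upwards [hS, iInter_mem.2 hV] with x hx hx'
    choose z hz hzx using mem_iInter.1 hx'
    obtain ⟨h1, h2⟩ := hUT (a := z) fun i _ => hz i
    exact hts (a := ⟨(z, x), hzx, h2⟩) (hTS ⟨h1, hx⟩)
  · intro e
    choose U hU hz hinj using fun i => hq.isLocallyInjective (e.point i)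
    refine ⟨⋂ i, (fun e' : FibreTuples q n => e'.point i) ⁻¹' U i,
      isOpen_iInter_of_finite fun i => (hU i).preimage (continuous_point i),
      mem_iInter.2 hz, fun r hr s hs h => eq_of_point_eq h fun i => ?_⟩
    exact hinj i (mem_iInter.1 hr i) (mem_iInter.1 hs i)
      ((map_point r i).trans (h.trans (map_point s i).symm))

end FibreTuples

end GaloisClosure

/-! ### Galois closure: the regular cover -/

section GaloisCover

variable {Z X : Type u} [TopologicalSpace Z] [TopologicalSpace X]

theorem IsLocalHomeomorph.finite_fiber [CompactSpace Z] [T2Space Z] [T2Space X] {q : Z → X}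
    (hq : IsLocalHomeomorph q) (x : X) : Finite (q ⁻¹' {x}) := by
  have : DiscreteTopology (q ⁻¹' {x}) := (isLocalHomeomorph_iff_isCoveringMap.1 hq x).1
  have : CompactSpace (q ⁻¹' {x}) :=
    isCompact_iff_compactSpace.1 (isClosed_singleton.preimage hq.continuous).isCompact
  exact finite_of_compact_of_discrete

namespace FibreTuples

variable {q : Z → X} {n : ℕ}

/-- Permuting the points of a tuple. -/
def permute (q : Z → X) {n : ℕ} (σ : Equiv.Perm (Fin n)) : FibreTuples q n ≃ₜ FibreTuples q n where
  toFun e := ⟨(e.point ∘ σ, e.proj), fun i => e.map_point (σ i), e.point_injective.comp σ.injective⟩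
  invFun e := ⟨(e.point ∘ σ.symm, e.proj), fun i => e.map_point (σ.symm i),
    e.point_injective.comp σ.symm.injective⟩
  left_inv e := eq_of_point_eq rfl fun i => congrArg e.point (σ.apply_symm_apply i)
  right_inv e := eq_of_point_eq rfl fun i => congrArg e.point (σ.symm_apply_apply i)
  continuous_toFun := Continuous.subtype_mk
    (.prodMk (continuous_pi fun i => continuous_point (σ i)) continuous_proj) _
  continuous_invFun := Continuous.subtype_mk
    (.prodMk (continuous_pi fun i => continuous_point (σ.symm i)) continuous_proj) _

/-- A missed point would extend `e` to a tuple of length one more. Tuples of that length would then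
exist over every point of `X`, in particular over `x₀`, whose fibre is too small. -/
theorem exists_point_eq [CompactSpace Z] [T2Space Z] [CompactSpace X] [ConnectedSpace X]
    [T2Space X] (hq : IsLocalHomeomorph q) (x₀ : X)
    (e : FibreTuples q (Nat.card (q ⁻¹' {x₀}))) {z : Z} (hz : q z = e.proj) :
    ∃ i, e.point i = z := by
  by_contra! hne
  have hfin : Finite (q ⁻¹' {x₀}) := hq.finite_fiber x₀
  let e' : FibreTuples q (Nat.card (q ⁻¹' {x₀}) + 1) :=
    ⟨(Fin.cons z e.point, e.proj), fun i => by
      refine Fin.cases ?_ (fun i => ?_) i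
      · exact hz
      · exact e.map_point i, Fin.cons_injective_iff.2 ⟨fun ⟨i, hi⟩ => hne i hi, e.point_injective⟩⟩
  have : Nonempty (FibreTuples q (Nat.card (q ⁻¹' {x₀}) + 1)) := ⟨e'⟩
  have : CompactSpace (FibreTuples q (Nat.card (q ⁻¹' {x₀}) + 1)) := compactSpace hq
  obtain ⟨d, hd⟩ := (isLocalHomeomorph_proj (n := Nat.card (q ⁻¹' {x₀}) + 1)
    hq).surjective_of_compact x₀
  have hinj : Function.Injective fun i => (⟨d.point i, (d.map_point i).trans hd⟩ : q ⁻¹' {x₀}) :=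
    fun i j h => d.point_injective (congrArg Subtype.val h)
  have := Nat.card_le_card_of_injective _ hinj
  exact absurd this (by rw [Nat.card_fin]; exact Nat.not_succ_le_self _)

end FibreTuples

/-- A local homeomorphism from a nonempty compact space to a connected space restricts to one on a
connected clopen set. -/
theorem IsLocalHomeomorph.exists_isClopen_connected [CompactSpace Z] [T2Space Z] [Nonempty Z]
    [ConnectedSpace X] [T2Space X] {q : Z → X} (hq : IsLocalHomeomorph q) :
    ∃ K : Set Z, IsClopen K ∧ K.Nonempty ∧
      ∀ A : Set Z, IsClopen A → (K ∩ A).Nonempty → K ⊆ A := by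
  obtain ⟨x₀⟩ : Nonempty X := inferInstance
  have hfin : (q ⁻¹' {x₀}).Finite := hq.finite_fiber x₀
  have hmeet : ∀ K : Set Z, IsClopen K → K.Nonempty → (K ∩ q ⁻¹' {x₀}).Nonempty := by
    intro K hK hne
    have : IsClopen (q '' K) :=
      ⟨(hK.1.isCompact.image hq.continuous).isClosed, hq.isOpenMap _ hK.2⟩
    obtain ⟨k, hk, hkx⟩ := (this.eq_univ (hne.image q)).ge (mem_univ x₀)
    exact ⟨k, hk, hkx⟩
  -- Every nonempty clopen set meets the finite fibre, so one with the fewest points there cannot be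
  -- split.
  obtain ⟨K, ⟨hK, hne⟩, hmin⟩ := (InvImage.wf (fun K : Set Z => (K ∩ q ⁻¹' {x₀}).ncard)
    wellFounded_lt).has_min {K | IsClopen K ∧ K.Nonempty} ⟨univ, isClopen_univ, univ_nonempty⟩
  refine ⟨K, hK, hne, fun A hA hKA => ?_⟩
  by_contra hsub
  obtain ⟨a, haK, haA⟩ := not_subset.1 hsub
  obtain ⟨b, ⟨hbK, hbA⟩, hbx⟩ := hmeet (K \ A) (hK.diff hA) ⟨a, haK, haA⟩
  refine hmin (K ∩ A) ⟨hK.inter hA, hKA⟩ (ncard_lt_ncard ?_ (hfin.inter_of_right K))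
  refine ⟨inter_subset_inter_left _ inter_subset_left, fun h => hbA (h ⟨hbK, hbx⟩).1.2⟩

open FibreTuples TopologicalSpace in
/-- Every local homeomorphism from a compact metrizable space to a continuum is dominated by a
regular cover by a continuum, in a way that relates any two points in corresponding fibres. -/
theorem exists_continuumCover_dominating [CompactSpace Z] [MetrizableSpace Z] [IsContinuum X]
    (x₀ : X) {q : Z → X} (hq : IsLocalHomeomorph q) :
    ∃ c : ContinuumCover X x₀, ∀ (w : c.space) (z : Z), q z = c.proj w →
      ∃ r : c.space → Z, Continuous r ∧ (∀ v, q (r v) = c.proj v) ∧ r w = z := by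
  -- `Z` may be empty. Then `n = 0`, and the tuples are just the points of `X`.
  set n := Nat.card (q ⁻¹' {x₀})
  have hfin : Finite (q ⁻¹' {x₀}) := hq.finite_fiber x₀
  have hE : Nonempty (FibreTuples q n) :=
    ⟨⟨(fun i => ((Finite.equivFin (q ⁻¹' {x₀})).symm i : Z), x₀),
      fun i => ((Finite.equivFin (q ⁻¹' {x₀})).symm i).2,
      Subtype.val_injective.comp (Equiv.injective _)⟩⟩
  have hEc : CompactSpace (FibreTuples q n) := compactSpace hq
  have hp : IsLocalHomeomorph (proj : FibreTuples q n → X) := isLocalHomeomorph_proj hq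
  obtain ⟨K, hK, hKne, hKmin⟩ := hp.exists_isClopen_connected
  have hKc : CompactSpace K := isCompact_iff_compactSpace.1 hK.1.isCompact
  have hKn : Nonempty K := hKne.to_subtype
  have hKp : PreconnectedSpace K := by
    rw [preconnectedSpace_iff_clopen]
    intro s hs
    rcases s.eq_empty_or_nonempty with h | ⟨k, hk⟩
    · exact .inl h
    · refine .inr (eq_univ_of_forall fun a => ?_)
      have := hKmin (Subtype.val '' s) ⟨hK.1.isClosedMap_subtype_val _ hs.1,
        hK.2.isOpenMap_subtype_val _ hs.2⟩ ⟨k, k.2, k, hk, rfl⟩ a.2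
      obtain ⟨b, hb, hba⟩ := this
      exact Subtype.ext hba ▸ hb
  have hKconn : ConnectedSpace K := ⟨hKn⟩
  have hpK : IsLocalHomeomorph fun k : K => k.1.proj :=
    hp.comp hK.2.isOpenEmbedding_subtypeVal.isLocalHomeomorph
  have hsurj := hpK.surjective_of_compact
  obtain ⟨k₀, hk₀⟩ := hsurj x₀
  let c : ContinuumCover X x₀ :=
    { space := K
      continuum := {}
      group :=
        { carrier := {h | ∀ k, (h k).1.proj = k.1.proj}
          one_mem' := fun _ => rfl
          mul_mem' := fun {a b} ha hb k => (ha (b k)).trans (hb k)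
          inv_mem' := fun {a} ha k => by
            have := ha (a.symm k)
            rw [a.apply_symm_apply] at this
            exact this.symm }
      proj := fun k => k.1.proj
      regular :=
        { covering := isLocalHomeomorph_iff_isCoveringMap.1 hpK
          quotient := hpK.isOpenMap.isQuotientMap hpK.continuous hsurj
          free := fun g hg y hy => Homeomorph.ext fun k => by
            exact congrFun (hpK.lift_unique g.continuous continuous_id (fun k => hg k) hy) k
          orbits := by
            intro y z
            constructor
            · intro h
              -- Both tuples enumerate the same whole fibre, so they differ by a permutation. It
              -- preserves `K` because it carries a point of `K` into `K` and `K` is minimal.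
              choose σ hσ using fun i =>
                y.1.exists_point_eq hq x₀ ((z.1.map_point i).trans h.symm)
              have hσi : Function.Injective σ := fun i j hij =>
                z.1.point_injective (by rw [← hσ i, ← hσ j, hij])
              let T := permute q (Equiv.ofBijective σ (Finite.injective_iff_bijective.1 hσi))
              have hT : T y.1 = z.1 := eq_of_point_eq h hσ
              have h1 : K ⊆ T ⁻¹' K :=
                hKmin _ (hK.preimage T.continuous) ⟨y.1, y.2, by simp [hT]⟩
              have h2 : K ⊆ T.symm ⁻¹' K :=
                hKmin _ (hK.preimage T.symm.continuous) ⟨z.1, z.2, by simp [← hT]⟩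
              refine ⟨T.subtype fun a => ⟨fun ha => h1 ha, fun ha => ?_⟩, fun k => rfl,
                Subtype.ext hT⟩
              simpa using h2 ha
            · rintro ⟨g, hg, rfl⟩
              exact (hg y).symm }
      base := k₀
      proj_base := hk₀ }
  refine ⟨c, fun w z hz => ?_⟩
  change K at w
  -- The dominating map is the coordinate at which the tuple `w` takes the value `z`.
  obtain ⟨i, hi⟩ := w.1.exists_point_eq hq x₀ hz
  exact ⟨fun k : K => k.1.point i, (continuous_point i).comp continuous_subtype_val,
    fun k => k.1.map_point i, hi⟩

end GaloisCover

/-! ### The compact universal cover: connectedness and lifting -/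

section InverseLimit

variable {X : Type u} [TopologicalSpace X] {x₀ : X}

theorem ContinuumCover.isLocalHomeomorph (c : ContinuumCover X x₀) : IsLocalHomeomorph c.proj :=
  c.regular.covering.isLocalHomeomorph

theorem ContinuumCover.continuous_proj (c : ContinuumCover X x₀) : Continuous c.proj :=
  c.isLocalHomeomorph.continuous

theorem IsBondingMap.proj_apply {c d : ContinuumCover X x₀} {b : d.space → c.space}
    (hb : IsBondingMap c d b) (z : d.space) : c.proj (b z) = d.proj z :=
  congrFun hb.proj_comp z

theorem IsBondingMap.eq {c d : ContinuumCover X x₀} {b b' : d.space → c.space}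
    (hb : IsBondingMap c d b) (hb' : IsBondingMap c d b') : b = b' :=
  c.isLocalHomeomorph.lift_unique hb.continuous hb'.continuous
    (fun z => by rw [hb.proj_apply, hb'.proj_apply]) (hb.map_base.trans hb'.map_base.symm)

theorem IsBondingMap.id (c : ContinuumCover X x₀) : IsBondingMap c c id :=
  ⟨continuous_id, Function.surjective_id, rfl, rfl⟩

theorem IsBondingMap.comp {c d e : ContinuumCover X x₀} {b : d.space → c.space}
    {b' : e.space → d.space} (hb : IsBondingMap c d b) (hb' : IsBondingMap d e b') :
    IsBondingMap c e (b ∘ b') :=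
  ⟨hb.continuous.comp hb'.continuous, hb.surjective.comp hb'.surjective, by
    rw [← Function.comp_assoc, hb.proj_comp, hb'.proj_comp], by
    rw [Function.comp_apply, hb'.map_base, hb.map_base]⟩

/-- Surjectivity is automatic: a lift of one local homeomorphism through another is a local
homeomorphism, here from a compact to a connected space. -/
theorem IsBondingMap.of_continuous {c d : ContinuumCover X x₀} {b : d.space → c.space}
    (hb : Continuous b) (hp : ∀ z, c.proj (b z) = d.proj z) (h₀ : b d.base = c.base) :
    IsBondingMap c d b :=
  have hcomp : c.proj ∘ b = d.proj := funext hp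
  ⟨hb, IsLocalHomeomorph.surjective_of_compact
    (.of_comp (hcomp ▸ d.isLocalHomeomorph) c.isLocalHomeomorph hb), hcomp, h₀⟩

theorem isBondingMap_trivialCover [IsContinuum X] (c : ContinuumCover X x₀) :
    IsBondingMap (trivialCover X x₀) c c.proj :=
  ⟨c.continuous_proj, c.regular.quotient.surjective, rfl, c.proj_base⟩

/-- Directedness of the covers: take a regular cover that dominates the fibre product and sends its
basepoint to the pair of basepoints. -/
theorem exists_isBondingMap_isBondingMap [IsContinuum X] (c d : ContinuumCover X x₀) :
    ∃ e : ContinuumCover X x₀, (∃ b, IsBondingMap c e b) ∧ ∃ b, IsBondingMap d e b := by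
  have := FibreProduct.compactSpace c.continuous_proj d.continuous_proj
  have hq : IsLocalHomeomorph fun p : FibreProduct c.proj d.proj => c.proj p.fst :=
    c.isLocalHomeomorph.comp
      (FibreProduct.isLocalHomeomorph_fst c.continuous_proj d.isLocalHomeomorph)
  obtain ⟨e, he⟩ := exists_continuumCover_dominating x₀ hq
  obtain ⟨r, hr, hrp, hr₀⟩ := he e.base
    ⟨(c.base, d.base), c.proj_base.trans d.proj_base.symm⟩ (c.proj_base.trans e.proj_base.symm)
  refine ⟨e, ⟨_, .of_continuous (FibreProduct.continuous_fst.comp hr) hrp ?_⟩,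
    ⟨_, .of_continuous (FibreProduct.continuous_snd.comp hr)
      (fun z => (r z).comm.symm.trans (hrp z)) ?_⟩⟩
  · exact congrArg FibreProduct.fst hr₀
  · exact congrArg FibreProduct.snd hr₀

namespace CompactUniversalCover

/-- The families of points whose coordinates below `e` are determined by the one at `e`. -/
def stage (e : ContinuumCover X x₀) : Set ((c : ContinuumCover X x₀) → c.space) :=
  {s | ∀ (c : ContinuumCover X x₀) (b : e.space → c.space), IsBondingMap c e b → b (s e) = s c}

theorem isClosed_stage (e : ContinuumCover X x₀) : IsClosed (stage e) := by
  simp only [stage, ofPred_forall]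
  exact isClosed_iInter fun c => isClosed_iInter fun b => isClosed_iInter fun hb =>
    isClosed_eq (hb.continuous.comp (continuous_apply e)) (continuous_apply c)

theorem stage_subset_of_isBondingMap {d e : ContinuumCover X x₀} {b : e.space → d.space}
    (hb : IsBondingMap d e b) : stage e ⊆ stage d := by
  intro s hs c b' hb'
  rw [← hs d b hb]
  exact hs c _ (hb'.comp hb)

theorem directed_stage [IsContinuum X] :
    Directed (· ⊇ ·) (stage : ContinuumCover X x₀ → Set _) := by
  intro c d
  obtain ⟨e, ⟨b, hb⟩, b', hb'⟩ := exists_isBondingMap_isBondingMap c d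
  exact ⟨e, stage_subset_of_isBondingMap hb, stage_subset_of_isBondingMap hb'⟩

open Classical in
/-- Replace the coordinates below `e` by the ones determined by the coordinate at `e`. -/
noncomputable def toStage (e : ContinuumCover X x₀) (s : (c : ContinuumCover X x₀) → c.space)
    (c : ContinuumCover X x₀) : c.space :=
  if h : ∃ b, IsBondingMap c e b then h.choose (s e) else s c

theorem toStage_of_isBondingMap {c e : ContinuumCover X x₀} {b : e.space → c.space}
    (hb : IsBondingMap c e b) (s : (c : ContinuumCover X x₀) → c.space) :
    toStage e s c = b (s e) := by
  have h : ∃ b, IsBondingMap c e b := ⟨b, hb⟩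
  rw [toStage, dif_pos h, h.choose_spec.eq hb]

theorem toStage_mem (e : ContinuumCover X x₀) (s : (c : ContinuumCover X x₀) → c.space) :
    toStage e s ∈ stage e := by
  intro c b hb
  rw [toStage_of_isBondingMap hb, toStage_of_isBondingMap (.id e), id]

theorem toStage_eq_self {e : ContinuumCover X x₀} {s : (c : ContinuumCover X x₀) → c.space}
    (hs : s ∈ stage e) : toStage e s = s := by
  funext c
  by_cases h : ∃ b, IsBondingMap c e b
  · obtain ⟨b, hb⟩ := h
    rw [toStage_of_isBondingMap hb, hs c b hb]
  · rw [toStage, dif_neg h]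

theorem continuous_toStage (e : ContinuumCover X x₀) : Continuous (toStage e) := by
  refine continuous_pi fun c => ?_
  by_cases h : ∃ b, IsBondingMap c e b
  · obtain ⟨b, hb⟩ := h
    simp only [toStage_of_isBondingMap hb]
    exact hb.continuous.comp (continuous_apply e)
  · simp only [toStage, dif_neg h]
    exact continuous_apply c

/-- A stage is a retract of the full product, which is connected. -/
theorem isPreconnected_stage (e : ContinuumCover X x₀) : IsPreconnected (stage e) := by
  have : stage e = range (toStage e) :=
    Subset.antisymm (fun s hs => ⟨s, toStage_eq_self hs⟩) (range_subset_iff.2 (toStage_mem e))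
  rw [this]
  exact isPreconnected_range (continuous_toStage e)

/-- The coherent families of points. -/
def coherent (x₀ : X) : Set ((c : ContinuumCover X x₀) → c.space) :=
  {s | ∀ (c d : ContinuumCover X x₀) (b : d.space → c.space), IsBondingMap c d b → b (s d) = s c}

theorem coherent_eq (x₀ : X) : coherent x₀ = ⋂ e, stage e := by
  ext s
  simp only [mem_iInter]
  exact ⟨fun h e c b hb => h c e b hb, fun h c e b hb => h e c b hb⟩

theorem isClosed_coherent (x₀ : X) : IsClosed (coherent x₀) := by
  rw [coherent_eq]
  exact isClosed_iInter isClosed_stage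

instance : CompactSpace (CompactUniversalCover X x₀) :=
  isCompact_iff_compactSpace.1 (isClosed_coherent x₀).isCompact

instance : T2Space (CompactUniversalCover X x₀) :=
  inferInstanceAs (T2Space (coherent x₀))

instance [IsContinuum X] : PreconnectedSpace (CompactUniversalCover X x₀) := by
  have : Nonempty (ContinuumCover X x₀) := ⟨trivialCover X x₀⟩
  have h : IsPreconnected (coherent x₀) := by
    rw [coherent_eq]
    exact isPreconnected_iInter_of_directed _ directed_stage isClosed_stage isPreconnected_stage
  exact isPreconnected_iff_preconnectedSpace.1 h

/-- The coordinate of a point of the compact universal cover. -/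
def coord (c : ContinuumCover X x₀) (s : CompactUniversalCover X x₀) : c.space := s.1 c

theorem continuous_coord (c : ContinuumCover X x₀) :
    Continuous (coord c : CompactUniversalCover X x₀ → c.space) :=
  (continuous_apply c).comp continuous_subtype_val

theorem coord_injective {s t : CompactUniversalCover X x₀} (h : ∀ c, coord c s = coord c t) :
    s = t :=
  Subtype.ext (funext h)

theorem map_coord {c d : ContinuumCover X x₀} {b : d.space → c.space} (hb : IsBondingMap c d b)
    (s : CompactUniversalCover X x₀) : b (coord d s) = coord c s :=
  s.2 c d b hb

theorem proj_coord [IsContinuum X] (c : ContinuumCover X x₀) (s : CompactUniversalCover X x₀) :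
    c.proj (coord c s) = compactUniversalCovering X x₀ s :=
  map_coord (isBondingMap_trivialCover c) s

/-- By compactness it suffices to find, in each stage, a family with value `w` at `c`. -/
theorem coord_surjective [IsContinuum X] (c : ContinuumCover X x₀) :
    Function.Surjective (coord c : CompactUniversalCover X x₀ → c.space) := by
  intro w
  have : Nonempty (ContinuumCover X x₀) := ⟨c⟩
  have hcl : ∀ e, IsClosed (stage e ∩ {s : (c : ContinuumCover X x₀) → c.space | s c = w}) :=
    fun e => (isClosed_stage e).inter (isClosed_eq (continuous_apply c) continuous_const)
  obtain ⟨s, hs⟩ := IsCompact.nonempty_iInter_of_directed_nonempty_isCompact_isClosed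
    (fun e => stage e ∩ {s : (c : ContinuumCover X x₀) → c.space | s c = w})
    (fun d e => by
      obtain ⟨k, hk, hk'⟩ := directed_stage d e
      exact ⟨k, inter_subset_inter_left _ hk, inter_subset_inter_left _ hk'⟩)
    (fun e => by
      classical
      obtain ⟨k, ⟨b, hb⟩, b', hb'⟩ := exists_isBondingMap_isBondingMap e c
      obtain ⟨v, rfl⟩ := hb'.surjective w
      -- Only the value `v` at `k` matters; the basepoints are fillers.
      refine ⟨toStage k (Function.update (fun c => c.base) k v),
        stage_subset_of_isBondingMap hb (toStage_mem k _), ?_⟩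
      change toStage k _ c = _
      rw [toStage_of_isBondingMap hb', Function.update_self])
    (fun e => (hcl e).isCompact) hcl
  rw [mem_iInter] at hs
  exact ⟨⟨s, fun c e b hb => (hs e).1 c b hb⟩, (hs c).2⟩

theorem continuous_compactUniversalCovering [IsContinuum X] :
    Continuous (compactUniversalCovering X x₀) :=
  continuous_coord (trivialCover X x₀)

theorem surjective_compactUniversalCovering [IsContinuum X] :
    Function.Surjective (compactUniversalCovering X x₀) :=
  coord_surjective (trivialCover X x₀)

open TopologicalSpace in
theorem exists_lift [IsContinuum X] {Z : Type u} [TopologicalSpace Z] [CompactSpace Z]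
    [MetrizableSpace Z] {q : Z → X} (hq : IsLocalHomeomorph q) (p : CompactUniversalCover X x₀)
    (z : Z) (hz : q z = compactUniversalCovering X x₀ p) :
    ∃ l : CompactUniversalCover X x₀ → Z, Continuous l ∧
      (∀ s, q (l s) = compactUniversalCovering X x₀ s) ∧ l p = z := by
  obtain ⟨c, hc⟩ := exists_continuumCover_dominating x₀ hq
  obtain ⟨r, hr, hrp, hr₀⟩ := hc (coord c p) z (hz.trans (proj_coord c p).symm)
  exact ⟨r ∘ coord c, hr.comp (continuous_coord c), fun s => (hrp _).trans (proj_coord c s), hr₀⟩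

open TopologicalSpace in
-- The pullback of `q` along `f` is a local homeomorphism to `Y`, to which `exists_lift` applies.
theorem exists_lift_comp {Y : Type u} [TopologicalSpace Y] [IsContinuum X] [IsContinuum Y]
    {y₀ : Y} {Z : Type u} [TopologicalSpace Z] [CompactSpace Z] [MetrizableSpace Z] {q : Z → X}
    (hq : IsLocalHomeomorph q) {f : Y → X} (hf : Continuous f) (p : CompactUniversalCover Y y₀)
    (z : Z) (hz : q z = f (compactUniversalCovering Y y₀ p)) :
    ∃ l : CompactUniversalCover Y y₀ → Z, Continuous l ∧
      (∀ s, q (l s) = f (compactUniversalCovering Y y₀ s)) ∧ l p = z := by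
  have := FibreProduct.compactSpace hf hq.continuous
  obtain ⟨l, hl, hlp, hl₀⟩ := exists_lift (FibreProduct.isLocalHomeomorph_fst hf hq) p
    ⟨(compactUniversalCovering Y y₀ p, z), hz.symm⟩ rfl
  exact ⟨_, FibreProduct.continuous_snd.comp hl,
    fun s => (l s).comm.symm.trans (congrArg f (hlp s)), congrArg FibreProduct.snd hl₀⟩

end CompactUniversalCover

end InverseLimit

/-! ### Finite coverings below a generalized regular covering -/

section GeneralizedRegularCovering

section Entourages

variable {Z : Type u} {Y : Type v} [UniformSpace Z] [UniformSpace Y] [CompactSpace Z]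
  [CompactSpace Y]

theorem IsLocallyInjective.exists_entourage {Y : Type v} {π : Z → Y} (hπ : IsLocallyInjective π) :
    ∃ I ∈ 𝓤 Z, ∀ z z', (z, z') ∈ I → π z = π z' → z = z' := by
  refine ⟨{p | π p.1 = π p.2 → p.1 = p.2}, ?_, fun z z' h => h⟩
  rw [← nhdsSet_diagonal_eq_uniformity, mem_nhdsSet_iff_forall]
  rintro ⟨z, w⟩ (rfl : z = w)
  obtain ⟨U, hU, hz, hinj⟩ := hπ z
  filter_upwards [prod_mem_nhds (hU.mem_nhds hz) (hU.mem_nhds hz)] with p hp h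
  exact hinj hp.1 hp.2 h

/-- Uniform openness: the pairs without a `D`-close lift lie in a compact set, the image of `Qᶜ`,
that misses the diagonal. -/
theorem IsOpenMap.exists_entourage_lift [T2Space Y] {π : Z → Y} (ho : IsOpenMap π)
    (hc : Continuous π) {D : Set (Z × Z)} (hD : D ∈ 𝓤 Z) :
    ∃ V ∈ 𝓤 Y, ∀ z y, (π z, y) ∈ V → ∃ z', π z' = y ∧ (z, z') ∈ D := by
  set Q : Set (Z × Y) := Prod.map id π '' interior D
  have hQ : IsOpen Q := (IsOpenMap.id.prodMap ho) _ isOpen_interior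
  have hK : IsClosed (Prod.map π id '' Qᶜ : Set (Y × Y)) :=
    (hQ.isClosed_compl.isCompact.image (hc.prodMap continuous_id)).isClosed
  refine ⟨(Prod.map π id '' Qᶜ)ᶜ, ?_, fun z y h => ?_⟩
  · rw [← nhdsSet_diagonal_eq_uniformity, hK.isOpen_compl.mem_nhdsSet]
    rintro ⟨y, w⟩ (rfl : y = w) ⟨⟨z, y'⟩, hz, he⟩
    simp only [Prod.map_apply, id, Prod.mk.injEq] at he
    exact hz ⟨(z, z), mem_interior_iff_mem_nhds.2 (nhds_le_uniformity z hD), by simp [he.1, he.2]⟩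
  · by_contra hne
    refine h ⟨(z, y), fun ⟨⟨a, a'⟩, ha, he⟩ => hne ?_, rfl⟩
    simp only [Prod.map_apply, id, Prod.mk.injEq] at he
    obtain ⟨rfl, rfl⟩ := he
    exact ⟨a', rfl, interior_subset ha⟩

end Entourages

section

variable {X : Type u} {Y : Type v} [UniformSpace X] [UniformSpace Y] {G : Subgroup (Equiv.Perm Y)}

theorem ActsIsomorphically.uniformContinuous (hG : ActsIsomorphically G) {g : Equiv.Perm Y}
    (hg : g ∈ G) : UniformContinuous g := by
  intro E hE
  obtain ⟨F, hF, hFE, hinv⟩ := hG E hE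
  rw [mem_map]
  filter_upwards [hF] with p hp
  exact hFE ((hinv g hg).le (mem_image_of_mem _ hp))

theorem IsGeneralizedRegularCovering.isOpenMap [CompactSpace Y] [T2Space X] {f : Y → X}
    (hf : IsGeneralizedRegularCovering G f) : IsOpenMap f := by
  have hc := hf.biUniform.1.continuous
  intro U hU
  rw [← (hc.isClosedMap.isQuotientMap hc hf.biUniform.2.1).isOpen_preimage]
  have : f ⁻¹' (f '' U) = ⋃ g ∈ G, g ⁻¹' U := by
    ext y
    simp only [mem_preimage, mem_image, mem_iUnion]
    constructor
    · rintro ⟨z, hz, h⟩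
      obtain ⟨g, hg, rfl⟩ := (hf.orbits y z).1 h.symm
      exact ⟨g, hg, hz⟩
    · rintro ⟨g, hg, hy⟩
      exact ⟨g y, hy, ((hf.orbits y (g y)).2 ⟨g, hg, rfl⟩).symm⟩
  rw [this]
  exact isOpen_biUnion fun g hg => hU.preimage (hf.isomorphic.uniformContinuous hg).continuous

end

section Stages

variable {X : Type u} {Y : Type v} {Z : Type u} [UniformSpace X] [UniformSpace Y] [UniformSpace Z]
  [CompactSpace Y] [T2Space Y] [CompactSpace Z] {G : Subgroup (Equiv.Perm Y)}

/-- The deck transformations in a small subgroup lift to a finite covering of the total space; this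
is the equivalence relation formed by the orbits of the lifts. -/
theorem IsGeneralizedRegularCovering.exists_setoid {f : Y → X}
    (hf : IsGeneralizedRegularCovering G f) {π : Z → Y} (hπ : IsLocalHomeomorph π)
    {E : Set (Z × Z)} (hE : E ∈ 𝓤 Z) :
    ∃ S : Setoid Z, (∀ z z', S z z' → (z, z') ∈ E) ∧ (∀ z z', S z z' → f (π z) = f (π z')) ∧
      (∃ W ∈ 𝓤 Z, ∀ z z' a a', S z z' → (z, a) ∈ W → (z', a') ∈ W → f (π a) = f (π a') →
        S a a') ∧
      ∀ z z', S z z' → ∀ O ∈ 𝓝 z', ∀ᶠ a in 𝓝 z, ∃ a' ∈ O, S a a' := by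
  obtain ⟨I, hI, hinj⟩ := hπ.isLocallyInjective.exists_entourage
  -- Points of one fibre of `π` joined by a chain of four `D`-steps coincide. This makes `D`-close
  -- lifts unique.
  obtain ⟨D, hDE, hD, hDsymm, hD4⟩ : ∃ D ⊆ E, D ∈ 𝓤 Z ∧ (∀ a b, (a, b) ∈ D → (b, a) ∈ D) ∧
      ∀ a b c d e, (a, b) ∈ D → (b, c) ∈ D → (c, d) ∈ D → (d, e) ∈ D → (a, e) ∈ I := by
    obtain ⟨D₁, hD₁, hD₁I⟩ := comp_mem_uniformity_sets hI
    obtain ⟨D₂, hD₂, hD₂D₁⟩ := comp_mem_uniformity_sets hD₁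
    obtain ⟨D, hD, hsymm, hDD⟩ := symm_of_uniformity (inter_mem hE hD₂)
    refine ⟨D, hDD.trans inter_subset_left, hD, fun a b => hsymm.symm a b, ?_⟩
    intro a b c d e hab hbc hcd hde
    exact hD₁I ⟨c, hD₂D₁ ⟨b, (hDD hab).2, (hDD hbc).2⟩, hD₂D₁ ⟨d, (hDD hcd).2, (hDD hde).2⟩⟩
  have hDrefl : ∀ z, (z, z) ∈ D := fun z => refl_mem_uniformity hD
  obtain ⟨V, hV, hlift⟩ := hπ.isOpenMap.exists_entourage_lift hπ.continuous hD
  obtain ⟨F₀, hF₀, hF₀V⟩ := hf.prodiscrete V hV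
  obtain ⟨F, hF, hFF₀, hFinv⟩ := hf.isomorphic F₀ hF₀
  set N := smallSubgroup G F
  have hS : somewhereSmall G F ⊆ somewhereSmall G F₀ :=
    fun g hg => ⟨hg.1, hg.2.imp fun y h => hFF₀ h⟩
  have hNV : ∀ n ∈ N, ∀ y, (y, n y) ∈ V := fun n hn =>
    (hF₀V (Subgroup.closure_mono hS hn)).2
  have hNG : N ≤ G := (Subgroup.closure_le G).2 fun g hg => hg.1
  have hfN : ∀ n ∈ N, ∀ y, f (n y) = f y := fun n hn y =>
    ((hf.orbits y (n y)).2 ⟨n, hNG hn, rfl⟩).symm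
  -- For transitivity, `n' * n` is again in `N` and so moves `π z` within `V`; its `D`-close lift
  -- must be `z''`.
  let S : Setoid Z :=
    { r := fun z z' => (z, z') ∈ D ∧ ∃ n ∈ N, π z' = n (π z)
      iseqv :=
        { refl := fun z => ⟨hDrefl z, 1, N.one_mem, rfl⟩
          symm := by
            rintro z z' ⟨h, n, hn, hnz⟩
            exact ⟨hDsymm _ _ h, n⁻¹, N.inv_mem hn, by
              rw [hnz]; exact (n.symm_apply_apply _).symm⟩
          trans := by
            rintro z z' z'' ⟨h, n, hn, hnz⟩ ⟨h', n', hn', hnz'⟩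
            have hz'' : π z'' = (n' * n) (π z) := by rw [hnz', hnz, Equiv.Perm.mul_apply]
            have hm := N.mul_mem hn' hn
            obtain ⟨w, hw, hzw⟩ := hlift z _ (hNV _ hm (π z))
            have : w = z'' := hinj _ _
              (hD4 w z z' z'' z'' (hDsymm _ _ hzw) h h' (hDrefl _)) (hw.trans hz''.symm)
            exact ⟨this ▸ hzw, _, hm, hz''⟩ } }
  obtain ⟨B, hB, hBsymm, hBF⟩ := comp_symm_mem_uniformity_sets hF
  obtain ⟨F₁, hF₁, hF₁B, hF₁inv⟩ := hf.isomorphic B hB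
  have hπu : UniformContinuous π := CompactSpace.uniformContinuous_of_continuous hπ.continuous
  have hW : D ∩ Prod.map π π ⁻¹' F₁ ∈ 𝓤 Z := inter_mem hD (hπu hF₁)
  have htrans : ∀ z z' a a', S z z' → (z, a) ∈ D ∩ Prod.map π π ⁻¹' F₁ →
      (z', a') ∈ D ∩ Prod.map π π ⁻¹' F₁ → f (π a) = f (π a') → S a a' := by
    rintro z z' a a' ⟨hzz', n, hn, hnz⟩ ⟨hza, hza₁⟩ ⟨hza', hza₁'⟩ hfa
    obtain ⟨h, hh, hha⟩ := (hf.orbits _ _).1 hfa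
    have h1 : (n (π z), n (π a)) ∈ B := hF₁B ((hF₁inv n (hNG hn)).le ⟨_, hza₁, rfl⟩)
    have h2 : (n (π z), h (π a)) ∈ B := by
      rw [hha, ← hnz]; exact hF₁B hza₁'
    -- Hence `n⁻¹ * h` moves the point `π a` by less than `F`, which puts it among the generators of
    -- `N`.
    have h3 : (n (π a), h (π a)) ∈ F := hBF ⟨_, hBsymm.symm _ _ h1, h2⟩
    have h4 : (π a, (n⁻¹ * h) (π a)) ∈ F := by
      have := (hFinv _ (G.inv_mem (hNG hn))).le ⟨_, h3, rfl⟩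
      simpa using this
    have h5 : n⁻¹ * h ∈ N :=
      Subgroup.subset_closure ⟨G.mul_mem (G.inv_mem (hNG hn)) hh, _, h4⟩
    have hhN : h ∈ N := by simpa using N.mul_mem hn h5
    obtain ⟨w, hw, haw⟩ := hlift a _ (hNV h hhN (π a))
    have : w = a' := hinj _ _
      (hD4 w a z z' a' (hDsymm _ _ haw) (hDsymm _ _ hza) hzz' hza') (hw.trans hha)
    exact ⟨this ▸ haw, h, hhN, hha.symm⟩
  refine ⟨S, fun z z' h => hDE h.1, ?_, ⟨_, hW, htrans⟩, ?_⟩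
  · rintro z z' ⟨-, n, hn, hnz⟩
    rw [hnz, hfN n hn]
  · intro z z' hzz' O hO
    obtain ⟨-, n, hn, hnz⟩ := id hzz'
    have hnc : Continuous fun a => n (π a) :=
      (hf.isomorphic.uniformContinuous (hNG hn)).continuous.comp hπ.continuous
    have hO' : π '' (O ∩ {a | (z', a) ∈ D ∩ Prod.map π π ⁻¹' F₁}) ∈ 𝓝 (n (π z)) := by
      rw [← hnz]
      exact hπ.isOpenMap.image_mem_nhds (inter_mem hO (mem_nhds_left z' hW))
    filter_upwards [hnc.continuousAt hO', mem_nhds_left z hW] with a ha ha'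
    obtain ⟨a', ⟨haO, haW⟩, hna⟩ := ha
    exact ⟨a', haO, htrans z z' a a' hzz' ha' haW (by rw [hna, hfN n hn])⟩

open TopologicalSpace in
/-- The composition of a finite covering and a generalized regular covering is a limit of finite
coverings. -/
theorem IsGeneralizedRegularCovering.exists_stage [T2Space X] [MetrizableSpace Z] {f : Y → X}
    (hf : IsGeneralizedRegularCovering G f) {π : Z → Y} (hπ : IsLocalHomeomorph π)
    {E : Set (Z × Z)} (hE : E ∈ 𝓤 Z) :
    ∃ (Z' : Type u) (_ : TopologicalSpace Z') (_ : CompactSpace Z') (_ : MetrizableSpace Z')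
      (r : Z → Z') (q : Z' → X), Continuous r ∧ IsLocalHomeomorph q ∧ (∀ z, q (r z) = f (π z)) ∧
        ∀ z z', r z = r z' → (z, z') ∈ E := by
  -- `htrans` makes `S` closed, so that the quotient is Hausdorff, and makes the induced map to `X`
  -- locally injective; `hopen` makes the quotient map open.
  obtain ⟨S, hSE, hSf, ⟨W, hW, htrans⟩, hopen⟩ := hf.exists_setoid hπ hE
  have hg : Continuous fun z => f (π z) := hf.biUniform.1.continuous.comp hπ.continuous
  have hgo : IsOpenMap fun z => f (π z) := hf.isOpenMap.comp hπ.isOpenMap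
  have hr : IsOpenQuotientMap (Quotient.mk S) := by
    refine ⟨Quotient.mk_surjective, continuous_quot_mk, fun O hO => ?_⟩
    refine isQuotientMap_quot_mk.isOpen_preimage.1 (isOpen_iff_mem_nhds.2 ?_)
    rintro z ⟨z', hz', hzz'⟩
    filter_upwards [hopen z z' (Quotient.exact hzz'.symm) O (hO.mem_nhds hz')] with a ⟨a', ha', h⟩
    exact ⟨a', ha', Quotient.sound (S.symm h)⟩
  have hT2 : T2Space (Quotient S) := by
    rw [t2Space_iff_of_isOpenQuotientMap hr, ← closure_subset_iff_isClosed]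
    rintro ⟨a, a'⟩ ha
    have hcl : IsClosed {p : Z × Z | f (π p.1) = f (π p.2)} :=
      isClosed_eq (hg.comp continuous_fst) (hg.comp continuous_snd)
    have hfa : f (π a) = f (π a') :=
      closure_minimal (fun p hp => hSf _ _ (Quotient.exact hp)) hcl ha
    obtain ⟨⟨z, z'⟩, ⟨hz, hz'⟩, h⟩ := mem_closure_iff_nhds.1 ha _
      (prod_mem_nhds (mem_nhds_right a hW) (mem_nhds_right a' hW))
    exact Quotient.sound (htrans z z' a a' (Quotient.exact h) hz hz' hfa)
  have hq : IsLocalHomeomorph (Quotient.lift (fun z => f (π z)) hSf) := by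
    refine .of_isOpenMap_isLocallyInjective (hg.quotient_lift _) (fun U hU => ?_) fun z => ?_
    · have := hgo _ (hU.preimage hr.continuous)
      convert this using 1
      ext x
      constructor
      · rintro ⟨z, hz, rfl⟩
        obtain ⟨z, rfl⟩ := Quotient.mk_surjective z
        exact ⟨z, hz, rfl⟩
      · rintro ⟨z, hz, rfl⟩
        exact ⟨_, hz, rfl⟩
    · obtain ⟨z, rfl⟩ := Quotient.mk_surjective z
      obtain ⟨O, hOW, hO, hz⟩ := mem_nhds_iff.1 (mem_nhds_left z hW)
      refine ⟨_, hr.isOpenMap O hO, ⟨z, hz, rfl⟩, ?_⟩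
      rintro _ ⟨a, ha, rfl⟩ _ ⟨a', ha', rfl⟩ h
      exact Quotient.sound (htrans z z a a' (S.refl z) (hOW ha) (hOW ha') h)
  have hsc : SecondCountableTopology (Quotient S) :=
    hr.isQuotientMap.secondCountableTopology hr.isOpenMap
  exact ⟨Quotient S, inferInstance, inferInstance, inferInstance, Quotient.mk S, _,
    hr.continuous, hq, fun z => rfl, fun z z' h => hSE _ _ (Quotient.exact h)⟩

end Stages

end GeneralizedRegularCovering

/-! ### Lifting through a finite covering followed by `f` -/

section Lifting

open CompactUniversalCover TopologicalSpace

variable {X Y Z : Type u} [UniformSpace X] [UniformSpace Y] [IsContinuum X] [IsContinuum Y]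
  [TopologicalSpace Z] [CompactSpace Z] {G : Subgroup (Equiv.Perm Y)} {f : Y → X} {π : Z → Y}

/-- The two lifts agree in every finite covering from `exists_stage`, hence are `E`-close for every
entourage `E`. -/
theorem IsGeneralizedRegularCovering.lift_unique [MetrizableSpace Z]
    (hf : IsGeneralizedRegularCovering G f)
    (hπ : IsLocalHomeomorph π) {A : Type*} [TopologicalSpace A] [PreconnectedSpace A] {l m : A → Z}
    (hl : Continuous l) (hm : Continuous m) (h : ∀ a, f (π (l a)) = f (π (m a))) {a₀ : A}
    (h₀ : l a₀ = m a₀) : l = m := by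
  let _ : UniformSpace Z := uniformSpaceOfCompactR1
  funext a
  refine eq_of_uniformity fun {E} hE => ?_
  obtain ⟨Z', _, _, _, r, q, hr, hq, hqr, hrE⟩ := hf.exists_stage hπ hE
  refine hrE _ _ (congrFun (hq.lift_unique (hr.comp hl) (hr.comp hm) (fun a => ?_)
    (congrArg r h₀)) a)
  simp only [Function.comp_apply, hqr, h]

/-- The approximations of a lift by the lifts to the finite coverings below `Z`. -/
theorem IsGeneralizedRegularCovering.exists_approximate_lift {Z : Type u} [UniformSpace Z]
    [CompactSpace Z] [MetrizableSpace Z] {π : Z → Y} (hf : IsGeneralizedRegularCovering G f)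
    (hπ : IsLocalHomeomorph π) {x₀ : X} (p : CompactUniversalCover X x₀) (z₀ : Z)
    (hz₀ : f (π z₀) = compactUniversalCovering X x₀ p) {E : Set (Z × Z)} (hE : E ∈ 𝓤 Z) :
    ∃ A : Set (CompactUniversalCover X x₀ × Z), IsClosed A ∧ (p, z₀) ∈ A ∧
      (∀ s z z', (s, z) ∈ A → (s, z') ∈ A → (z, z') ∈ E) ∧
      ∀ s z, (s, z) ∈ A → ∃ O ∈ 𝓝 z, ∀ᶠ s' in 𝓝 s, ∀ z' ∈ O,
        f (π z') = compactUniversalCovering X x₀ s' → (s', z') ∈ A := by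
  obtain ⟨Z', _, _, _, r, q, hr, hq, hqr, hrE⟩ := hf.exists_stage hπ hE
  obtain ⟨l, hl, hql, hl₀⟩ := exists_lift hq p (r z₀) ((hqr z₀).trans hz₀)
  refine ⟨{a | r a.2 = l a.1}, isClosed_eq (hr.comp continuous_snd) (hl.comp continuous_fst),
    hl₀.symm, fun s z z' h h' => hrE z z' (Eq.trans h (Eq.symm h')), fun s z hsz => ?_⟩
  replace hsz : r z = l s := hsz
  obtain ⟨U, hU, hz, hinj⟩ := hq.isLocallyInjective (r z)
  refine ⟨r ⁻¹' U, hr.continuousAt (hU.mem_nhds hz), ?_⟩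
  filter_upwards [hl.continuousAt (hU.mem_nhds (hsz ▸ hz))] with s' hs' z' hz' h
  exact hinj hz' hs' (by rw [hqr, h, hql])

/-- The composition of a finite covering and a generalized regular covering is covered by the
compact universal cover. -/
theorem IsGeneralizedRegularCovering.exists_lift [MetrizableSpace Z]
    (hf : IsGeneralizedRegularCovering G f) (hπ : IsLocalHomeomorph π) {x₀ : X}
    (p : CompactUniversalCover X x₀) (z₀ : Z)
    (hz₀ : f (π z₀) = compactUniversalCovering X x₀ p) :
    ∃ l : CompactUniversalCover X x₀ → Z, Continuous l ∧
      (∀ s, f (π (l s)) = compactUniversalCovering X x₀ s) ∧ l p = z₀ := by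
  let _ : UniformSpace Z := uniformSpaceOfCompactR1
  have hg : Continuous fun z => f (π z) := hf.biUniform.1.continuous.comp hπ.continuous
  have hgo : IsOpenMap fun z => f (π z) := hf.isOpenMap.comp hπ.isOpenMap
  choose A hA hA₀ hAE hAO using fun E : {E // E ∈ 𝓤 Z} =>
    hf.exists_approximate_lift hπ p z₀ hz₀ E.2
  let B (E : {E // E ∈ 𝓤 Z}) : Set (CompactUniversalCover X x₀ × Z) :=
    A E ∩ {a | f (π a.2) = compactUniversalCovering X x₀ a.1}
  have hB : ∀ E, IsClosed (B E) := fun E => (hA E).inter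
    (isClosed_eq (hg.comp continuous_snd) (continuous_compactUniversalCovering.comp continuous_fst))
  -- The stages for different `E` are not compared. Instead the common points of finitely many `A E`
  -- over `X` project to a clopen set: closed by compactness, open because `f ∘ π` is open. It
  -- contains `p`.
  have hfin : ∀ (I : Finset {E // E ∈ 𝓤 Z}) (s : CompactUniversalCover X x₀), ∃ z,
      f (π z) = compactUniversalCovering X x₀ s ∧ ∀ E ∈ I, (s, z) ∈ A E := by
    intro I
    let C : Set (CompactUniversalCover X x₀ × Z) :=
      {a | f (π a.2) = compactUniversalCovering X x₀ a.1 ∧ ∀ E ∈ I, a ∈ A E}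
    have hC : IsClosed C := by
      have : C = {a | f (π a.2) = compactUniversalCovering X x₀ a.1} ∩ ⋂ E ∈ I, A E := by
        ext a
        simp [C]
      rw [this]
      exact (isClosed_eq (hg.comp continuous_snd)
        (continuous_compactUniversalCovering.comp continuous_fst)).inter
          (isClosed_biInter fun E _ => hA E)
    have hclopen : IsClopen (Prod.fst '' C) := by
      refine ⟨(hC.isCompact.image continuous_fst).isClosed, isOpen_iff_mem_nhds.2 ?_⟩
      rintro _ ⟨⟨s, z⟩, ⟨hz, hsz⟩, rfl⟩
      choose! O hO hO' using fun E (hE : E ∈ I) => hAO E s z (hsz E hE)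
      have h1 : (fun z => f (π z)) '' (⋂ E ∈ I, O E) ∈ 𝓝 (compactUniversalCovering X x₀ s) := by
        rw [← hz]
        exact hgo.image_mem_nhds ((Filter.biInter_finset_mem I).2 hO)
      filter_upwards [continuous_compactUniversalCovering.continuousAt h1,
        (Filter.eventually_all_finset I).2 hO'] with s' hs' hs''
      obtain ⟨z', hz', hzs'⟩ := hs'
      exact ⟨(s', z'), ⟨hzs', fun E hE => hs'' E hE z' (mem_iInter₂.1 hz' E hE) hzs'⟩, rfl⟩
    intro s
    obtain ⟨⟨_, z⟩, hz, rfl⟩ := (hclopen.eq_univ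
      ⟨p, (p, z₀), ⟨hz₀, fun E _ => hA₀ E⟩, rfl⟩).ge (mem_univ s)
    exact ⟨z, hz⟩
  have hex : ∀ s, ∃ z, ∀ E, (s, z) ∈ B E := by
    intro s
    obtain ⟨z, hz⟩ := CompactSpace.iInter_nonempty (t := fun E => {z | (s, z) ∈ B E})
      (fun E => (hB E).preimage (Continuous.prodMk_right s)) fun I => by
        obtain ⟨z, hz, hzI⟩ := hfin I s
        exact ⟨z, mem_iInter₂.2 fun E hE => ⟨hzI E hE, hz⟩⟩
    exact ⟨z, fun E => mem_iInter.1 hz E⟩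
  choose l hl using hex
  have huniq : ∀ s z, (∀ E, (s, z) ∈ B E) → l s = z := fun s z hz =>
    eq_of_uniformity fun {E} hE => hAE ⟨E, hE⟩ s _ _ (hl s ⟨E, hE⟩).1 (hz ⟨E, hE⟩).1
  refine ⟨l, continuous_iff_isClosed.2 fun K hK => ?_, fun s => (hl s ⟨univ, univ_mem⟩).2,
    huniq p z₀ fun E => ⟨hA₀ E, hz₀⟩⟩
  -- The graph of `l` is the closed set `⋂ E, B E` in a compact product.
  have : l ⁻¹' K = Prod.fst '' ((⋂ E, B E) ∩ Prod.snd ⁻¹' K) := by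
    ext s
    constructor
    · exact fun hs => ⟨(s, l s), ⟨mem_iInter.2 (hl s), hs⟩, rfl⟩
    · rintro ⟨⟨s, z⟩, ⟨hz, hzK⟩, rfl⟩
      rw [mem_preimage, huniq s z (mem_iInter.1 hz)]
      exact hzK
  rw [this]
  exact (((isClosed_iInter hB).inter (hK.preimage continuous_snd)).isCompact.image
    continuous_fst).isClosed

end Lifting

/-! ### The homeomorphism and its uniqueness -/

section Main

open CompactUniversalCover

variable {X Y : Type u} [UniformSpace X] [UniformSpace Y] [IsContinuum X] [IsContinuum Y]
  {G : Subgroup (Equiv.Perm Y)} {f : Y → X}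

theorem IsGeneralizedRegularCovering.exists_homeomorph (hf : IsGeneralizedRegularCovering G f)
    (x₀ : X) (y₀ : Y) :
    ∃ h : CompactUniversalCover X x₀ ≃ₜ CompactUniversalCover Y y₀,
      compactUniversalCovering X x₀ = f ∘ compactUniversalCovering Y y₀ ∘ h := by
  obtain ⟨q⟩ : Nonempty (CompactUniversalCover Y y₀) :=
    ⟨(surjective_compactUniversalCovering y₀).choose⟩
  -- `p` and `q` anchor all lifts, so `x₀` and `y₀` need not correspond under `f`.
  obtain ⟨p, hp⟩ := surjective_compactUniversalCovering (x₀ := x₀)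
    (f (compactUniversalCovering Y y₀ q))
  have hfc : Continuous f := hf.biUniform.1.continuous
  choose l hl hlp hl₀ using fun d : ContinuumCover Y y₀ =>
    hf.exists_lift d.isLocalHomeomorph p (coord d q) (by rw [proj_coord, hp])
  choose m hm hmp hm₀ using fun c : ContinuumCover X x₀ =>
    exists_lift_comp c.isLocalHomeomorph hfc q (coord c p) (by rw [proj_coord, hp])
  let H : CompactUniversalCover X x₀ → CompactUniversalCover Y y₀ := fun s =>
    ⟨fun d => l d s, fun c d b hb => congrFun (hf.lift_unique c.isLocalHomeomorph
      (hb.continuous.comp (hl d)) (hl c)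
      (fun s => by rw [Function.comp_apply, hb.proj_apply, hlp, hlp]) (a₀ := p)
      (by rw [Function.comp_apply, hl₀, hl₀, map_coord hb])) s⟩
  let K : CompactUniversalCover Y y₀ → CompactUniversalCover X x₀ := fun s =>
    ⟨fun c => m c s, fun c d b hb => congrFun (c.isLocalHomeomorph.lift_unique
      (hb.continuous.comp (hm d)) (hm c)
      (fun s => by rw [Function.comp_apply, hb.proj_apply, hmp, hmp]) (a₀ := q)
      (by rw [Function.comp_apply, hm₀, hm₀, map_coord hb])) s⟩
  have hH : Continuous H := Continuous.subtype_mk (continuous_pi hl) _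
  have hK : Continuous K := Continuous.subtype_mk (continuous_pi hm) _
  have hHf : ∀ s, f (compactUniversalCovering Y y₀ (H s)) = compactUniversalCovering X x₀ s :=
    fun s => hlp (trivialCover Y y₀) s
  have hKf : ∀ s, compactUniversalCovering X x₀ (K s) = f (compactUniversalCovering Y y₀ s) :=
    fun s => hmp (trivialCover X x₀) s
  have hHp : H p = q := coord_injective fun d => hl₀ d
  have hKq : K q = p := coord_injective fun c => hm₀ c
  refine ⟨⟨⟨H, K, fun s => coord_injective fun c => ?_, fun s => coord_injective fun d => ?_⟩,
    hH, hK⟩, funext fun s => (hHf s).symm⟩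
  · exact congrFun (c.isLocalHomeomorph.lift_unique ((continuous_coord c).comp (hK.comp hH))
      (continuous_coord c) (fun s => by
        simp only [Function.comp_apply, proj_coord, hKf, hHf]) (a₀ := p)
      (by simp only [Function.comp_apply, hHp, hKq])) s
  · exact congrFun (hf.lift_unique d.isLocalHomeomorph
      ((continuous_coord d).comp (hH.comp hK)) (continuous_coord d) (fun s => by
        simp only [Function.comp_apply, proj_coord, hKf, hHf]) (a₀ := q)
      (by simp only [Function.comp_apply, hHp, hKq])) s

theorem compactUniversalCovering_smul {x₀ : X} (g : profiniteFundamentalGroup X x₀)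
    (s : CompactUniversalCover X x₀) :
    compactUniversalCovering X x₀ (g • s) = compactUniversalCovering X x₀ s := by
  have h : (g.1 (trivialCover X x₀)).1 = 1 := Subgroup.mem_bot.1 (g.1 (trivialCover X x₀)).2
  exact congrArg (fun e : X ≃ₜ X => e (compactUniversalCovering X x₀ s)) h

/-- The continuous self-maps of the compact universal cover over `X` are given by the profinite
fundamental group. -/
theorem exists_smul_eq_of_comp_eq {x₀ : X}
    {k : CompactUniversalCover X x₀ → CompactUniversalCover X x₀} (hk : Continuous k)
    (hkp : ∀ s, compactUniversalCovering X x₀ (k s) = compactUniversalCovering X x₀ s) :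
    ∃ g : profiniteFundamentalGroup X x₀, ∀ s, k s = g • s := by
  obtain ⟨s₀⟩ : Nonempty (CompactUniversalCover X x₀) :=
    ⟨(surjective_compactUniversalCovering x₀).choose⟩
  -- On each cover, take the deck transformation that agrees with `k` at `s₀`. Uniqueness of lifts
  -- extends the agreement to all points, and surjectivity of the coordinates then gives coherence.
  choose g hg hg₀ using fun c : ContinuumCover X x₀ =>
    (c.regular.orbits (coord c s₀) (coord c (k s₀))).1 (by rw [proj_coord, proj_coord, hkp])
  have hgk : ∀ c s, g c (coord c s) = coord c (k s) := fun c s =>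
    congrFun (c.isLocalHomeomorph.lift_unique ((g c).continuous.comp (continuous_coord c))
      ((continuous_coord c).comp hk) (fun s => by
        simp only [Function.comp_apply]
        rw [← (c.regular.orbits _ _).2 ⟨g c, hg c, rfl⟩, proj_coord, proj_coord, hkp]) (hg₀ c)) s
  refine ⟨⟨fun c => ⟨g c, hg c⟩, fun c d b hb z => ?_⟩, fun s => coord_injective fun c =>
    (hgk c s).symm⟩
  obtain ⟨s, rfl⟩ := coord_surjective d z
  change g c (b (coord d s)) = b (g d (coord d s))
  rw [map_coord hb, hgk, hgk, map_coord hb]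

end Main

theorem corollary5 {X Y : Type u} [UniformSpace X] [UniformSpace Y] [IsContinuum X] [IsContinuum Y]
    (G : Subgroup (Equiv.Perm Y)) (f : Y → X) (hf : IsGeneralizedRegularCovering G f)
    (x₀ : X) (y₀ : Y) :
    ∃ h : CompactUniversalCover X x₀ ≃ₜ CompactUniversalCover Y y₀,
      compactUniversalCovering X x₀ = f ∘ compactUniversalCovering Y y₀ ∘ h ∧
      ∀ h' : CompactUniversalCover X x₀ ≃ₜ CompactUniversalCover Y y₀,
        compactUniversalCovering X x₀ = f ∘ compactUniversalCovering Y y₀ ∘ h' ↔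
          ∃ g : profiniteFundamentalGroup X x₀, ∀ s, h' s = h (g • s) := by
  obtain ⟨h, hh⟩ := hf.exists_homeomorph x₀ y₀
  refine ⟨h, hh, fun h' => ⟨fun hh' => ?_, ?_⟩⟩
  · obtain ⟨g, hg⟩ := exists_smul_eq_of_comp_eq (k := fun s => h.symm (h' s))
      (h.symm.continuous.comp h'.continuous) fun s => by
        conv_lhs => rw [hh]
        conv_rhs => rw [hh']
        simp
    exact ⟨g, fun s => by rw [← hg, h.apply_symm_apply]⟩
  · rintro ⟨g, hg⟩
    funext s
    rw [← compactUniversalCovering_smul g s, hh]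
    simp only [Function.comp_apply, hg]
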